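/- Let $r>7$ be a prime, let $\zeta_r$ be a primitive $r$-th root of unity, and put $\xi_n=\zeta_r^{n}+\zeta_r^{-n}$ for $n\ge 0$, and $K_r=\mathbb{Q}(\zeta_r)^+=\mathbb{Q}(\zeta_r+\zeta_r^{-1})$. Let $k=(k_1,k_2,k_3)$ be $(1,2,3)$ or $(1,2,4)$, let $(a,b)\in\mathbb{Z}^2$ with $(a,b)\neq(0,0)$, and set $$A=(\xi_{k_3}-\xi_{k_2})(a^2+\xi_{k_1}ab+b^2),\qquad B=(\xi_{k_1}-\xi_{k_3})(a^2+\xi_{k_2}ab+b^2).$$ Then the generalized Frey curve $$E^k_{(a,b),r}\colon\quad Y^2=X(X-A)(X+B)$$ is an elliptic curve over $K_r$, and it is $3$-ordinary: for every prime $\mathfrak{p}$ of $K_r$ above $3$, it has good reduction at $\mathfrak{p}$, and this reduction is ordinary, i.e. $3\nmid a_{\mathfrak{p}}(E^k_{(a,b),r})$. Here $a_{\mathfrak{p}}(E)=q+1-\#\tilde E(\mathbb{F}_q)$, where $\mathbb{F}_q$ is the residue field of $\mathfrak{p}$ and $\tilde E$ is the reduction modulo $\mathfrak{p}$ of a minimal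 Weierstrass equation of $E$ at $\mathfrak{p}$. -/

import Mathlib

open NumberField IsDedekindDomain

noncomputable section

namespace FreyOrdinary

section Ordinary

variable {K : Type*} [Field K] [NumberField K]

/-- The valuation ring in `K` of the `v`-adic valuation, for a finite prime `v` of `K`. It is the
localization of the ring of integers at `v`; its residue field is the residue field of `v`. -/
abbrev localRing (v : HeightOneSpectrum (𝓞 K)) : Subring K :=
  (v.valuation K).integer

/-- `E` has good reduction at `v`: the discriminant of a minimal Weierstrass equation of `E` at `v`
is a `v`-adic unit. -/
def HasGoodReductionAt (E : WeierstrassCurve K) (v : HeightOneSpectrum (𝓞 K)) : Prop :=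
  (E.minimal (localRing v)).HasGoodReduction (localRing v)

/-- The reduction of (a minimal Weierstrass equation of) `E` modulo `v`, a Weierstrass curve over
the residue field of `v`. -/
def reductionAt (E : WeierstrassCurve K) (v : HeightOneSpectrum (𝓞 K)) :
    WeierstrassCurve (IsLocalRing.ResidueField (localRing v)) :=
  (E.minimal (localRing v)).reduction (localRing v)

/-- The trace of Frobenius `a_v(E) = q + 1 - #Ẽ(𝔽_q)`, where `𝔽_q` is the residue field of `v` and
`Ẽ` is the reduction of `E` modulo `v` (the type of points includes the point at infinity). -/
def traceOfFrobenius (E : WeierstrassCurve K) (v : HeightOneSpectrum (𝓞 K)) : ℤ :=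
  (Nat.card (IsLocalRing.ResidueField (localRing v)) : ℤ) + 1
    - (Nat.card (reductionAt E v).toAffine.Point : ℤ)

/-- `E` is `p`-ordinary: at every prime `v` of `K` above `p` it has good reduction, and this
reduction is ordinary, that is, `p` does not divide `a_v(E)`. -/
def IsPOrdinary (p : ℕ) (E : WeierstrassCurve K) : Prop :=
  ∀ v : HeightOneSpectrum (𝓞 K), (p : 𝓞 K) ∈ v.asIdeal →
    HasGoodReductionAt E v ∧ ¬ (p : ℤ) ∣ traceOfFrobenius E v

end Ordinary

section Frey

variable {L : Type*} [Field L] [NumberField L]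

/-- The field `ℚ(ζ + ζ⁻¹)`; when `ζ` is a primitive `r`-th root of unity this is the maximal totally
real subfield `ℚ(ζ)⁺` of the cyclotomic field `ℚ(ζ)`. -/
abbrev realField (ζ : L) : IntermediateField ℚ L :=
  IntermediateField.adjoin ℚ {ζ + ζ⁻¹}

theorem pow_add_inv_pow_mem (ζ : L) (n : ℕ) : ζ ^ n + (ζ ^ n)⁻¹ ∈ realField ζ := by
  rcases eq_or_ne ζ 0 with rfl | hζ
  · rcases n with _ | n
    · simpa using add_mem (one_mem (realField (0 : L))) (one_mem (realField (0 : L)))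
    · simp
  · have h1 : ζ + ζ⁻¹ ∈ realField ζ :=
      IntermediateField.subset_adjoin ℚ {ζ + ζ⁻¹} rfl
    induction n using Nat.strong_induction_on with
    | _ n ih =>
      match n, ih with
      | 0, _ => simpa using add_mem (one_mem (realField ζ)) (one_mem (realField ζ))
      | 1, _ => simpa using h1
      | n + 2, ih =>
        have e : ζ ^ (n + 2) + (ζ ^ (n + 2))⁻¹
            = (ζ + ζ⁻¹) * (ζ ^ (n + 1) + (ζ ^ (n + 1))⁻¹) - (ζ ^ n + (ζ ^ n)⁻¹) := by
          field_simp
          ring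
        rw [e]
        exact sub_mem (mul_mem h1 (ih (n + 1) (by omega))) (ih n (by omega))

/-- `ξ_n = ζ ^ n + ζ ^ (-n)`, as an element of `ℚ(ζ + ζ⁻¹)`. -/
def xi (ζ : L) (n : ℕ) : realField ζ :=
  ⟨ζ ^ n + (ζ ^ n)⁻¹, pow_add_inv_pow_mem ζ n⟩

/-- `A^k(a, b, ζ) = (ξ_{k₃} - ξ_{k₂}) (a² + ξ_{k₁} a b + b²)`, with `k = (k₁, k₂, k₃)`. -/
def freyA (ζ : L) (k : ℕ × ℕ × ℕ) (a b : ℤ) : realField ζ :=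
  (xi ζ k.2.2 - xi ζ k.2.1) * ((a : realField ζ) ^ 2 + xi ζ k.1 * a * b + (b : realField ζ) ^ 2)

/-- `B^k(a, b, ζ) = (ξ_{k₁} - ξ_{k₃}) (a² + ξ_{k₂} a b + b²)`, with `k = (k₁, k₂, k₃)`. -/
def freyB (ζ : L) (k : ℕ × ℕ × ℕ) (a b : ℤ) : realField ζ :=
  (xi ζ k.1 - xi ζ k.2.2) * ((a : realField ζ) ^ 2 + xi ζ k.2.1 * a * b + (b : realField ζ) ^ 2)

/-- The generalized Frey curve `Y² = X (X - A) (X + B) = X³ + (B - A) X² - A B X` over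
`ℚ(ζ + ζ⁻¹)`. -/
def freyCurve (ζ : L) (k : ℕ × ℕ × ℕ) (a b : ℤ) : WeierstrassCurve (realField ζ) where
  a₁ := 0
  a₂ := freyB ζ k a b - freyA ζ k a b
  a₃ := 0
  a₄ := -(freyA ζ k a b * freyB ζ k a b)
  a₆ := 0

end Frey

end FreyOrdinary

end

/-! Over a finite field of characteristic 3, counting points on a curve modulo 3 gives a trace of
Frobenius equal to a power of `b₂`, and `c₄ = b₂ ^ 2` there. Hence an integral model whose `Δ` and
`c₄` are units at a prime above 3 has good ordinary reduction (`good_ordinary_of_integral_model`).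

For the Frey curve, `Δ = 16 A² B² (A + B)²` and `c₄ ≡ 16 (B - A)²` modulo 3. A common factor of `a`
and `b` only changes the model by a scaling, so `a` and `b` may be taken coprime; their residues
then form a nonzero pair in `{0, 1, -1}`. Let `z ≠ 1` be the image of `ζ` in a residue field above
3, so that `z ^ r = 1`. Up to sign and powers of `z`, the values of `A`, `B`, `A + B` at such pairs
are products of factors `z ^ n ± 1`, nonzero because `r > 7` is an odd prime. The values of `B - A`
factor modulo 3 into the same kind of terms, except for two cubics dividing `z ^ 13 + 1`
(`hasse_symmetric_ne_zero_one_two_three`, `hasse_symmetric_ne_zero_one_two_four`). -/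

/-! ### Point counts modulo 3. -/

open Polynomial in
theorem Polynomial.coeff_pow_three_mul_add {F : Type*} [CommRing F] [CharP F 3] (P : F[X])
    (m i : ℕ) (hi : i < 3) : (P ^ 3).coeff (3 * m + i) = if i = 0 then P.coeff m ^ 3 else 0 := by
  have : Fact (Nat.Prime 3) := ⟨Nat.prime_three⟩
  have : ExpChar F 3 := ExpChar.prime Nat.prime_three
  rw [← map_frobenius_expand, coeff_map, coeff_expand (by norm_num)]
  split_ifs with h1 h2 h2
  · subst h2
    simp [frobenius_def]
  · omega
  · omega
  · simp

open Polynomial in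
/-- In characteristic `3` the Hasse invariant of a cubic is the norm of its `X ^ 2`-coefficient. -/
theorem Polynomial.coeff_cubic_pow_of_charP_three {F : Type*} [CommRing F] [CharP F 3]
    (a b c d : F) (n e : ℕ) (he : 2 * e + 1 = 3 ^ n) :
    ((C a * X ^ 3 + C b * X ^ 2 + C c * X + C d) ^ e).coeff (2 * e) = b ^ e := by
  induction n generalizing e with
  | zero =>
    obtain rfl : e = 0 := by simpa using he
    simp
  | succ n ih =>
    obtain ⟨f, hf⟩ : Odd (3 ^ n) := Odd.pow (by decide)
    obtain rfl : e = 3 * f + 1 := by rw [pow_succ] at he; omega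
    have ih := ih f hf.symm
    set D := C a * X ^ 3 + C b * X ^ 2 + C c * X + C d with hD
    -- `(D ^ f) ^ 3` is a polynomial in `X ^ 3`, and `2 * (3 * f + 1) ≡ 2` modulo 3, so only the `X
    -- ^ 2` term of the remaining factor `D` contributes.
    have key : D ^ (3 * f + 1) = C a * ((D ^ f) ^ 3 * X ^ 3) + C b * ((D ^ f) ^ 3 * X ^ 2)
        + C c * ((D ^ f) ^ 3 * X ^ 1) + C d * (D ^ f) ^ 3 := by
      rw [pow_succ, mul_comm 3 f, pow_mul]
      conv_lhs => rw [mul_comm]; arg 1; rw [hD]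
      ring
    have h0 : ((D ^ f) ^ 3).coeff (2 * (3 * f + 1)) = 0 := by
      rw [show 2 * (3 * f + 1) = 3 * (2 * f) + 2 by ring, coeff_pow_three_mul_add _ _ _ (by simp)]
      simp
    have h1 : ((D ^ f) ^ 3).coeff (2 * (3 * f + 1) - 1) = 0 := by
      rw [show 2 * (3 * f + 1) - 1 = 3 * (2 * f) + 1 by omega,
        coeff_pow_three_mul_add _ _ _ (by simp)]
      simp
    have h2 : ((D ^ f) ^ 3).coeff (2 * (3 * f + 1) - 2) = (b ^ f) ^ 3 := by
      rw [show 2 * (3 * f + 1) - 2 = 3 * (2 * f) + 0 by omega,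
        coeff_pow_three_mul_add _ _ _ (by simp), ih]
      simp
    have h3 : (if 3 ≤ 2 * (3 * f + 1) then ((D ^ f) ^ 3).coeff (2 * (3 * f + 1) - 3) else 0)
        = 0 := by
      split_ifs with h
      · rw [show 2 * (3 * f + 1) - 3 = 3 * (2 * f - 1) + 2 by omega,
          coeff_pow_three_mul_add _ _ _ (by simp)]
        simp
      · rfl
    rw [key]
    simp only [coeff_add, coeff_C_mul, coeff_mul_X_pow', h0, h1, h2, h3]
    rw [if_pos (by omega), if_pos (by omega)]
    ring

theorem FiniteField.sum_pow_card_sub_one {F : Type*} [Field F] [Fintype F] :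
    ∑ x : F, x ^ (Fintype.card F - 1) = -1 := by
  classical
  have hq : 1 < Fintype.card F := Fintype.one_lt_card
  have h (x : F) : x ^ (Fintype.card F - 1) = 1 - if x = 0 then 1 else 0 := by
    split_ifs with hx
    · rw [hx, zero_pow (by omega)]; simp
    · rw [FiniteField.pow_card_sub_one_eq_one x hx]; simp
  simp [h]

theorem FiniteField.sum_pow_of_lt {F : Type*} [Field F] [Fintype F] (i : ℕ)
    (hi : i < 2 * (Fintype.card F - 1)) :
    ∑ x : F, x ^ i = if i = Fintype.card F - 1 then -1 else 0 := by
  have hq : 1 < Fintype.card F := Fintype.one_lt_card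
  rcases lt_trichotomy i (Fintype.card F - 1) with h | rfl | h
  · rw [if_neg h.ne, FiniteField.sum_pow_lt_card_sub_one F i h]
  · rw [if_pos rfl, FiniteField.sum_pow_card_sub_one]
  · rw [if_neg h.ne', ← FiniteField.sum_pow_lt_card_sub_one F (i - (Fintype.card F - 1)) (by omega)]
    refine Finset.sum_congr rfl fun x _ => ?_
    obtain ⟨j, rfl⟩ : ∃ j, i = Fintype.card F + j := ⟨i - Fintype.card F, by omega⟩
    rw [pow_add, FiniteField.pow_card, ← pow_succ']
    congr 1
    omega

/-- Power sums over the field vanish except at positive multiples of `q - 1`; the degree bound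
leaves only the first of these. -/
theorem FiniteField.sum_eval_of_natDegree_lt {F : Type*} [Field F] [Fintype F]
    (P : Polynomial F) (hP : P.natDegree < 2 * (Fintype.card F - 1)) :
    ∑ x : F, P.eval x = -P.coeff (Fintype.card F - 1) := by
  have hq : 1 < Fintype.card F := Fintype.one_lt_card
  simp_rw [Polynomial.eval_eq_sum_range' hP]
  rw [Finset.sum_comm]
  simp_rw [← Finset.mul_sum]
  rw [Finset.sum_congr rfl fun i hi => by
    rw [FiniteField.sum_pow_of_lt i (Finset.mem_range.1 hi)]]
  simp only [mul_ite, mul_neg, mul_one, mul_zero, Finset.sum_ite_eq', Finset.mem_range]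
  rw [if_pos (by omega)]

/-- The affine points of an elliptic curve, as solutions of its equation. -/
def WeierstrassCurve.Affine.pointEquivOption {F : Type*} [Field F] (W : WeierstrassCurve F)
    [W.IsElliptic] : W.toAffine.Point ≃ Option {p : F × F // W.toAffine.Equation p.1 p.2} where
  toFun
    | .zero => none
    | .some x y h => some ⟨(x, y), h.1⟩
  invFun
    | none => .zero
    | some p => .some p.1.1 p.1.2 (WeierstrassCurve.Affine.equation_iff_nonsingular.1 p.2)
  left_inv P := by cases P <;> rfl
  right_inv P := by cases P <;> rfl

/-- The number of points above `x`, modulo the characteristic. -/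
theorem WeierstrassCurve.card_fiber {F : Type*} [Field F] [Fintype F] (h2 : ringChar F ≠ 2)
    (W : WeierstrassCurve F) (x : F) :
    (Nat.card {y : F // W.toAffine.Equation x y} : F) =
      1 + (4 * x ^ 3 + W.b₂ * x ^ 2 + 2 * W.b₄ * x + W.b₆) ^ (Fintype.card F / 2) := by
  classical
  have h20 : (2 : F) ≠ 0 := Ring.two_ne_zero h2
  set D := 4 * x ^ 3 + W.b₂ * x ^ 2 + 2 * W.b₄ * x + W.b₆ with hD
  -- Completing the square: `z = 2 y + a₁ x + a₃` turns the fibre into the square roots of `D`,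
  -- counted by the quadratic character.
  let e : {y : F // W.toAffine.Equation x y} ≃ {z : F | z ^ 2 = D} :=
    { toFun := fun y => ⟨2 * y.1 + (W.a₁ * x + W.a₃), by
        have h := (WeierstrassCurve.Affine.equation_iff ..).1 y.2
        simp only [Set.mem_ofPred_eq, hD, WeierstrassCurve.b₂, WeierstrassCurve.b₄,
          WeierstrassCurve.b₆]
        linear_combination 4 * h⟩
      invFun := fun z => ⟨(z.1 - (W.a₁ * x + W.a₃)) / 2, by
        have h : z.1 ^ 2 = D := z.2
        rw [WeierstrassCurve.Affine.equation_iff]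
        simp only [hD, WeierstrassCurve.b₂, WeierstrassCurve.b₄, WeierstrassCurve.b₆] at h
        have h40 : (4 : F) ≠ 0 := by
          rw [show (4 : F) = 2 * 2 by norm_num]
          exact mul_ne_zero h20 h20
        apply mul_left_cancel₀ h40
        field_simp
        linear_combination h⟩
      left_inv := fun y => by
        ext
        field_simp
        ring
      right_inv := fun z => by
        ext
        field_simp
        ring }
  have h := quadraticChar_card_sqrts h2 D
  rw [Nat.card_congr e, Nat.card_eq_card_toFinset]
  have h' := congrArg (Int.cast : ℤ → F) h
  rw [Int.cast_natCast, Int.cast_add, quadraticChar_eq_pow_of_char_ne_two' h2, Int.cast_one] at h'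
  rw [h', add_comm]

open Polynomial in
/-- The trace of Frobenius in characteristic `3` is congruent to the norm of `b₂`. -/
theorem WeierstrassCurve.trace_cast_of_charP_three {F : Type*} [Field F] [Finite F] [CharP F 3]
    (W : WeierstrassCurve F) [W.IsElliptic] :
    (((Nat.card F : ℤ) + 1 - (Nat.card W.toAffine.Point : ℤ) : ℤ) : F) =
      W.b₂ ^ (Nat.card F / 2) := by
  classical
  have := Fintype.ofFinite F
  have hc : ringChar F = 3 := ringChar.eq F 3 ▸ rfl
  have h2 : ringChar F ≠ 2 := by rw [hc]; norm_num
  obtain ⟨n, -, hn⟩ := FiniteField.card F 3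
  obtain ⟨e, he⟩ : Odd (3 ^ (n : ℕ)) := Odd.pow (by decide)
  -- This gives `e ≥ 1`, needed for the strict bound `3 e < 4 e = 2 (q - 1)` on the degree of `P`.
  have hn1 : 3 ≤ 3 ^ (n : ℕ) := by
    simpa using Nat.pow_le_pow_right (show 0 < 3 by norm_num) n.pos
  have he2 : Fintype.card F / 2 = e := by omega
  have hq0 : (Fintype.card F : F) = 0 := FiniteField.cast_card_eq_zero F
  have h1 : (Nat.card {p : F × F // W.toAffine.Equation p.1 p.2} : F) =
      -W.b₂ ^ e := by
    have hs : {p : F × F // W.toAffine.Equation p.1 p.2} ≃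
        Σ x : F, {y : F // W.toAffine.Equation x y} :=
      { toFun := fun p => ⟨p.1.1, p.1.2, p.2⟩
        invFun := fun p => ⟨(p.1, p.2.1), p.2.2⟩
        left_inv := fun _ => rfl
        right_inv := fun _ => rfl }
    set P : F[X] := (C 4 * X ^ 3 + C W.b₂ * X ^ 2 + C (2 * W.b₄) * X + C W.b₆) ^ e with hP
    have hdeg : P.natDegree < 2 * (Fintype.card F - 1) := by
      have : P.natDegree ≤ e * 3 := by
        refine natDegree_pow_le.trans (Nat.mul_le_mul_left _ ?_)
        compute_degree
      omega
    have hsum := FiniteField.sum_eval_of_natDegree_lt P hdeg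
    rw [show Fintype.card F - 1 = 2 * e by omega, hP,
      coeff_cubic_pow_of_charP_three _ _ _ _ n e he.symm] at hsum
    rw [Nat.card_congr hs, Nat.card_sigma, Nat.cast_sum, ← hsum]
    simp only [W.card_fiber h2, Finset.sum_add_distrib, he2]
    simp [hq0]
  rw [Nat.card_congr (WeierstrassCurve.Affine.pointEquivOption W), Nat.card_eq_fintype_card,
    Finite.card_option, he2]
  push_cast
  rw [h1, hq0]
  ring

/-! ### Passage to the minimal model. -/

open IsDedekindDomain.HeightOneSpectrum IsDiscreteValuationRing in
/-- If some integral model of `E` has unit discriminant, so has the minimal model; if that model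
also has unit `c₄`, so has the minimal one. -/
theorem WeierstrassCurve.isUnit_integralModel_minimal {R : Type*} [CommRing R] [IsDomain R]
    [IsDiscreteValuationRing R] {K : Type*} [Field K] [Algebra R K] [IsFractionRing R K]
    (E : WeierstrassCurve K) (W : WeierstrassCurve R) (C : VariableChange K)
    (hC : C • E = W.map (algebraMap R K)) (hΔ : IsUnit W.Δ) :
    IsUnit (integralModel R (E.minimal R)).Δ ∧
      (IsUnit W.c₄ → IsUnit (integralModel R (E.minimal R)).c₄) := by
  obtain ⟨C₁, hC₁⟩ : ∃ C₁ : VariableChange K, E.minimal R = C₁ • E :=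
    ⟨_, rfl⟩
  have hC₂ : (C * C₁⁻¹) • E.minimal R = W.map (algebraMap R K) := by
    rw [hC₁, mul_smul, inv_smul_smul, hC]
  set M := E.minimal R with hM
  set C₂ := C * C₁⁻¹
  have hint : IsIntegral R (C₂ • M) := ⟨W, hC₂⟩
  have val_one (x : R) : valuation K (maximalIdeal R) (algebraMap R K x) = 1 ↔ IsUnit x := by
    rw [valuation_eq_one_iff_notMem]
    exact not_iff_comm.1 (IsLocalRing.mem_maximalIdeal x).symm
  have hmax := (IsMinimal.val_Δ_maximal (R := R) (W := M)).2 hint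
  have hΔM : IsUnit (integralModel R M).Δ := by
    have h1 : valuation_Δ_aux R (C₂ • M) ≤ valuation_Δ_aux R M := by
      rcases le_total (valuation_Δ_aux R ((1 : VariableChange K) • M))
        (valuation_Δ_aux R (C₂ • M)) with h | h
      · simpa using hmax h
      · simpa using h
    have h2 := Subtype.coe_le_coe.2 h1
    rw [valuation_Δ_aux_eq_of_isIntegral, valuation_Δ_aux_eq_of_isIntegral, hC₂, map_Δ,
      (val_one _).2 hΔ, ← integralModel_Δ_eq R M] at h2
    rw [← val_one]
    exact le_antisymm (valuation_le_one _ _) h2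
  refine ⟨hΔM, fun hc => ?_⟩
  -- Invariance of `j = c₄ ^ 3 / Δ`, with denominators cleared.
  have hj : (integralModel R M).c₄ ^ 3 * W.Δ = W.c₄ ^ 3 * (integralModel R M).Δ := by
    apply IsFractionRing.injective R K
    rw [map_mul, map_mul, map_pow, map_pow, integralModel_Δ_eq, integralModel_c₄_eq,
      ← map_Δ W (algebraMap R K), ← map_c₄ W (algebraMap R K), ← hC₂, variableChange_Δ,
      variableChange_c₄]
    ring
  have h3 : IsUnit ((integralModel R M).c₄ ^ 3 * W.Δ) := hj ▸ (hc.pow 3).mul hΔM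
  exact (isUnit_pow_iff three_ne_zero).1 (isUnit_of_mul_isUnit_left h3)

/-! ### A criterion for good ordinary reduction above 3. -/

namespace FreyOrdinary

variable {K : Type*} [Field K] [NumberField K]

/-- The inclusion of the ring of integers in the local ring at `v`. -/
noncomputable def toLocalRing (v : HeightOneSpectrum (𝓞 K)) : 𝓞 K →+* localRing v :=
  (algebraMap (𝓞 K) K).codRestrict (localRing v) fun x => v.valuation_le_one x

theorem isUnit_toLocalRing_iff (v : HeightOneSpectrum (𝓞 K)) (x : 𝓞 K) :
    IsUnit (toLocalRing v x) ↔ x ∉ v.asIdeal := by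
  rw [(Valuation.integer.integers (v.valuation K)).isUnit_iff_valuation_eq_one]
  exact v.valuation_eq_one_iff_notMem

/-- Algebraic integers approximate every `v`-integral element modulo the maximal ideal. The residue
field is therefore a quotient of the finite ring `𝓞 K ⧸ v.asIdeal`. -/
theorem residue_toLocalRing_surjective (v : HeightOneSpectrum (𝓞 K)) :
    Function.Surjective ((IsLocalRing.residue (localRing v)).comp (toLocalRing v)) := by
  intro y
  obtain ⟨x, rfl⟩ := IsLocalRing.residue_surjective y
  obtain ⟨a, ha⟩ := v.exists_valuation_sub_lt_of_integer (x := (x : K)) x.2 1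
  refine ⟨a, ?_⟩
  rw [RingHom.comp_apply, ← sub_eq_zero, ← map_sub, IsLocalRing.residue_eq_zero_iff,
    IsLocalRing.mem_maximalIdeal, mem_nonunits_iff, Valuation.Integer.not_isUnit_iff_valuation_lt_one]
  exact ha

theorem finite_residueField (v : HeightOneSpectrum (𝓞 K)) :
    Finite (IsLocalRing.ResidueField (localRing v)) := by
  have : Finite (𝓞 K ⧸ v.asIdeal) := v.asIdeal.finiteQuotientOfFreeOfNeBot v.ne_bot
  refine Finite.of_surjective
    (Ideal.Quotient.lift v.asIdeal ((IsLocalRing.residue (localRing v)).comp (toLocalRing v))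
      fun x hx => ?_)
    (Ideal.Quotient.lift_surjective_of_surjective _ _ (residue_toLocalRing_surjective v))
  rw [RingHom.comp_apply, IsLocalRing.residue_eq_zero_iff, IsLocalRing.mem_maximalIdeal,
    mem_nonunits_iff, isUnit_toLocalRing_iff, not_not]
  exact hx

/-- An elliptic curve with a model over the integers whose discriminant and `c₄` are units at a
prime above `3` has good ordinary reduction there. -/
theorem good_ordinary_of_integral_model (E : WeierstrassCurve K) (v : HeightOneSpectrum (𝓞 K))
    (hv : ((3 : ℕ) : 𝓞 K) ∈ v.asIdeal) (W : WeierstrassCurve (𝓞 K))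
    (C : WeierstrassCurve.VariableChange K) (hC : C • E = W.map (algebraMap (𝓞 K) K))
    (hΔ : W.Δ ∉ v.asIdeal) (hc₄ : W.c₄ ∉ v.asIdeal) :
    HasGoodReductionAt E v ∧ ¬ ((3 : ℕ) : ℤ) ∣ traceOfFrobenius E v := by
  have hmap : C • E = (W.map (toLocalRing v)).map (algebraMap (localRing v) K) := by
    rw [WeierstrassCurve.map_map]
    exact hC
  obtain ⟨h1, h2⟩ := E.isUnit_integralModel_minimal (W.map (toLocalRing v)) C hmap
    (by rwa [WeierstrassCurve.map_Δ, isUnit_toLocalRing_iff])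
  have h2 := h2 (by rwa [WeierstrassCurve.map_c₄, isUnit_toLocalRing_iff])
  have hell : (reductionAt E v).IsElliptic := by
    rw [WeierstrassCurve.isElliptic_iff, reductionAt, WeierstrassCurve.reduction,
      WeierstrassCurve.map_Δ]
    exact h1.map _
  refine ⟨WeierstrassCurve.hasGoodReduction_iff_isElliptic_reduction _ |>.2 hell, fun hdvd => ?_⟩
  have := finite_residueField v
  have h3 : ((3 : ℕ) : IsLocalRing.ResidueField (localRing v)) = 0 := by
    rw [← map_natCast ((IsLocalRing.residue (localRing v)).comp (toLocalRing v)),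
      RingHom.comp_apply, IsLocalRing.residue_eq_zero_iff, IsLocalRing.mem_maximalIdeal,
      mem_nonunits_iff, isUnit_toLocalRing_iff, not_not]
    exact hv
  have : CharP (IsLocalRing.ResidueField (localRing v)) 3 :=
    (CharP.charP_iff_prime_eq_zero Nat.prime_three).2 h3
  -- In characteristic 3, `c₄ = b₂ ^ 2 - 24 b₄` is just `b₂ ^ 2`.
  have hb : (reductionAt E v).b₂ ≠ 0 := by
    intro hb
    have hc : IsUnit (reductionAt E v).c₄ := by
      rw [reductionAt, WeierstrassCurve.reduction, WeierstrassCurve.map_c₄]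
      exact h2.map _
    refine hc.ne_zero ?_
    rw [WeierstrassCurve.c₄, hb]
    push_cast at h3
    linear_combination (-8 * (reductionAt E v).b₄) * h3
  have htr := (reductionAt E v).trace_cast_of_charP_three
  refine pow_ne_zero _ hb (htr.symm.trans ?_)
  obtain ⟨m, hm⟩ := hdvd
  have hm' : (Nat.card (IsLocalRing.ResidueField (localRing v)) : ℤ) + 1
    - (Nat.card (reductionAt E v).toAffine.Point : ℤ) = (3 : ℕ) * m := hm
  rw [hm', Int.cast_mul, Int.cast_natCast, h3, zero_mul]

end FreyOrdinary

universe u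

namespace FreyOrdinary

/-! ### Nonvanishing in characteristic 3. -/

section CharThree

variable {F : Type*} [Field F] {z : F}

/-- Multiplied by `z ^ i`, the difference becomes `(z ^ (i + j) - 1) * (z ^ (i - j) - 1)`. -/
theorem sub_trace_pow_ne_zero (hz : z ≠ 0) (h1 : ∀ n, 0 < n → n ≤ 7 → z ^ n ≠ 1) {i j : ℕ}
    (hj : j < i) (hij : i + j ≤ 7) :
    (z ^ i + (z ^ i)⁻¹) - (z ^ j + (z ^ j)⁻¹) ≠ 0 := by
  obtain ⟨m, rfl⟩ := Nat.exists_eq_add_of_lt hj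
  intro h
  have hm := mul_ne_zero (sub_ne_zero.2 (h1 (j + m + 1 + j) (by omega) hij))
    (sub_ne_zero.2 (h1 (m + 1) (by omega) (by omega)))
  refine hm ?_
  field_simp at h
  apply mul_left_cancel₀ (pow_ne_zero j hz)
  linear_combination h

theorem quadratic_form_ne_zero (hz : z ≠ 0) (hm : ∀ m, z ^ m ≠ -1)
    (h1 : ∀ n, 0 < n → n ≤ 7 → z ^ n ≠ 1) {n : ℕ} (hn : 0 < n) (hn7 : n ≤ 7) {a b : F}
    (ha : a = 0 ∨ a = 1 ∨ a = -1) (hb : b = 0 ∨ b = 1 ∨ b = -1) (hab : a ≠ 0 ∨ b ≠ 0) :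
    a ^ 2 + (z ^ n + (z ^ n)⁻¹) * a * b + b ^ 2 ≠ 0 := by
  have hzn : z ^ n ≠ 0 := pow_ne_zero n hz
  have hp : z ^ n + 1 ≠ 0 := fun h => hm n (eq_neg_of_add_eq_zero_left h)
  have hs : z ^ n - 1 ≠ 0 := sub_ne_zero.2 (h1 n hn hn7)
  have hf : z ^ n * (a ^ 2 + (z ^ n + (z ^ n)⁻¹) * a * b + b ^ 2)
      = (a + z ^ n * b) * (z ^ n * a + b) := by
    field_simp
    ring
  intro h
  rw [h, mul_zero] at hf
  rcases ha with rfl | rfl | rfl <;> rcases hb with rfl | rfl | rfl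
  · simp at hab
  · exact hzn (by linear_combination -hf)
  · exact hzn (by linear_combination -hf)
  · exact hzn (by linear_combination -hf)
  · exact mul_ne_zero hp hp (by linear_combination -hf)
  · exact mul_ne_zero hs hs (by linear_combination hf)
  · exact hzn (by linear_combination -hf)
  · exact mul_ne_zero hs hs (by linear_combination hf)
  · exact mul_ne_zero hp hp (by linear_combination -hf)

/-- Up to sign and powers of `z`, the three expressions factor modulo 3 as `(z - 1)² (z⁴ + 1)`, `(z
+ 1)² (z - 1) (z⁷ - 1)` and `(z - 1)⁴ (1 + 2z² + z³) (1 + 2z + z³)`. -/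
theorem hasse_symmetric_ne_zero_one_two_three (h3 : (3 : F) = 0) (hz : z ≠ 0)
    (hm : ∀ m, z ^ m ≠ -1) (h1 : ∀ n, 0 < n → n ≤ 7 → z ^ n ≠ 1) {x : ℕ → F}
    (hx : ∀ n, x n = z ^ n + (z ^ n)⁻¹) :
    x 1 + x 2 + x 3 ≠ 0 ∧
      x 1 + x 2 + x 3 + (x 1 * x 2 + x 1 * x 3 + x 2 * x 3) ≠ 0 ∧
      x 1 + x 2 + x 3 - (x 1 * x 2 + x 1 * x 3 + x 2 * x 3) ≠ 0 := by
  have hs (n : ℕ) (h0 : 0 < n) (h7 : n ≤ 7) : z ^ n - 1 ≠ 0 := sub_ne_zero.2 (h1 n h0 h7)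
  have hp (n : ℕ) : z ^ n + 1 ≠ 0 := fun h => hm n (eq_neg_of_add_eq_zero_left h)
  have s1 := hs 1 (by simp) (by simp)
  have s7 := hs 7 (by simp) (by simp)
  -- The two reciprocal cubics divide `z ^ 13 + 1` modulo 3; the first factor in each combination is
  -- the cofactor.
  have hf : 1 + 2 * z ^ 2 + z ^ 3 ≠ 0 := fun h => hp 13 <| by
    linear_combination (1 + z ^ 2 - z ^ 3 + z ^ 4 + z ^ 5 - z ^ 6 + z ^ 8 + z ^ 9 + z ^ 10) * h
      - (z ^ 2 + z ^ 4 + z ^ 7 + z ^ 10 + z ^ 11 + z ^ 12) * h3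
  have hg : 1 + 2 * z + z ^ 3 ≠ 0 := fun h => hp 13 <| by
    linear_combination (1 + z + z ^ 2 - z ^ 4 + z ^ 5 + z ^ 6 - z ^ 7 + z ^ 8 + z ^ 10) * h
      - (z + z ^ 2 + z ^ 3 + z ^ 6 + z ^ 9 + z ^ 11) * h3
  simp only [hx]
  refine ⟨fun h => mul_ne_zero (pow_ne_zero 2 s1) (hp 4) ?_,
    fun h => mul_ne_zero (mul_ne_zero (pow_ne_zero 2 (hp 1)) s1) s7 ?_,
    fun h => mul_ne_zero (mul_ne_zero (pow_ne_zero 4 s1) hf) hg ?_⟩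
  · have e : z ^ 3 * (z ^ 1 + (z ^ 1)⁻¹ + (z ^ 2 + (z ^ 2)⁻¹) + (z ^ 3 + (z ^ 3)⁻¹))
        = 1 + z + z ^ 2 + z ^ 4 + z ^ 5 + z ^ 6 := by
      field_simp
      ring
    rw [h, mul_zero] at e
    linear_combination -e - (z + z ^ 5) * h3
  · have e := congrArg (z ^ 5 * ·) h
    field_simp at e
    linear_combination e - (z ^ 2 + z ^ 3 + z ^ 4 + z ^ 6 + z ^ 7 + z ^ 8) * h3
  · have e := congrArg (z ^ 5 * ·) h
    field_simp at e
    linear_combination -e + (-z + 2 * z ^ 3 - 6 * z ^ 4 + 8 * z ^ 5 - 6 * z ^ 6 + 2 * z ^ 7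
      - z ^ 9) * h3

/-- The factorizations modulo 3, up to sign and powers of `z`, are now `(z - 1)⁶ (z² + 1)`, `(z -
1)⁵ (z⁷ - 1)` and `(z - 1)¹⁰ (z + 1)²`. -/
theorem hasse_symmetric_ne_zero_one_two_four (h3 : (3 : F) = 0) (hz : z ≠ 0)
    (hm : ∀ m, z ^ m ≠ -1) (h1 : ∀ n, 0 < n → n ≤ 7 → z ^ n ≠ 1) {x : ℕ → F}
    (hx : ∀ n, x n = z ^ n + (z ^ n)⁻¹) :
    x 1 + x 2 + x 4 ≠ 0 ∧
      x 1 + x 2 + x 4 + (x 1 * x 2 + x 1 * x 4 + x 2 * x 4) ≠ 0 ∧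
      x 1 + x 2 + x 4 - (x 1 * x 2 + x 1 * x 4 + x 2 * x 4) ≠ 0 := by
  have hs (n : ℕ) (h0 : 0 < n) (h7 : n ≤ 7) : z ^ n - 1 ≠ 0 := sub_ne_zero.2 (h1 n h0 h7)
  have hp (n : ℕ) : z ^ n + 1 ≠ 0 := fun h => hm n (eq_neg_of_add_eq_zero_left h)
  have s1 := hs 1 (by simp) (by simp)
  have s7 := hs 7 (by simp) (by simp)
  simp only [hx]
  refine ⟨fun h => mul_ne_zero (pow_ne_zero 6 s1) (hp 2) ?_,
    fun h => mul_ne_zero (pow_ne_zero 5 s1) s7 ?_,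
    fun h => mul_ne_zero (pow_ne_zero 10 s1) (pow_ne_zero 2 (hp 1)) ?_⟩
  · have e := congrArg (z ^ 4 * ·) h
    field_simp at e
    linear_combination e - (2 * z - 5 * z ^ 2 + 9 * z ^ 3 - 10 * z ^ 4 + 9 * z ^ 5 - 5 * z ^ 6
      + 2 * z ^ 7) * h3
  · have e := congrArg (z ^ 6 * ·) h
    field_simp at e
    linear_combination e - (2 * z - 3 * z ^ 2 + 4 * z ^ 3 - z ^ 4 + z ^ 5 + z ^ 7 - z ^ 8
      + 4 * z ^ 9 - 3 * z ^ 10 + 2 * z ^ 11) * h3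
  · have e := congrArg (z ^ 6 * ·) h
    field_simp at e
    linear_combination -e + (-3 * z + 9 * z ^ 2 - 14 * z ^ 3 + 5 * z ^ 4 + 16 * z ^ 5
      - 28 * z ^ 6 + 16 * z ^ 7 + 5 * z ^ 8 - 14 * z ^ 9 + 9 * z ^ 10 - 3 * z ^ 11) * h3

/-- In characteristic `3`, the Hasse invariant `B - A` of the Frey curve is given by elementary
symmetric functions, and does not vanish as soon as three of its values do not. -/
theorem hasse_frey_ne_zero (h3 : (3 : F) = 0) (x₁ x₂ x₃ : F)
    (h : x₁ + x₂ + x₃ ≠ 0 ∧ x₁ + x₂ + x₃ + (x₁ * x₂ + x₁ * x₃ + x₂ * x₃) ≠ 0 ∧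
      x₁ + x₂ + x₃ - (x₁ * x₂ + x₁ * x₃ + x₂ * x₃) ≠ 0) {a b : F}
    (ha : a = 0 ∨ a = 1 ∨ a = -1) (hb : b = 0 ∨ b = 1 ∨ b = -1) (hab : a ≠ 0 ∨ b ≠ 0) :
    (x₁ - x₃) * (a ^ 2 + x₂ * a * b + b ^ 2) - (x₃ - x₂) * (a ^ 2 + x₁ * a * b + b ^ 2) ≠ 0 := by
  obtain ⟨h0, hp, hm⟩ := h
  have e : (x₁ - x₃) * (a ^ 2 + x₂ * a * b + b ^ 2) - (x₃ - x₂) * (a ^ 2 + x₁ * a * b + b ^ 2)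
      = (x₁ + x₂ + x₃) * (a ^ 2 + b ^ 2) - (x₁ * x₂ + x₁ * x₃ + x₂ * x₃) * (a * b) := by
    linear_combination (x₁ * x₂ * a * b - x₃ * (a ^ 2 + b ^ 2)) * h3
  rw [e]
  intro hh
  rcases ha with rfl | rfl | rfl <;> rcases hb with rfl | rfl | rfl
  · simp at hab
  · exact h0 (by linear_combination hh)
  · exact h0 (by linear_combination hh)
  · exact h0 (by linear_combination hh)
  · exact hp (by linear_combination (x₁ + x₂ + x₃) * h3 - hh)
  · exact hm (by linear_combination (x₁ + x₂ + x₃) * h3 - hh)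
  · exact h0 (by linear_combination hh)
  · exact hm (by linear_combination (x₁ + x₂ + x₃) * h3 - hh)
  · exact hp (by linear_combination (x₁ + x₂ + x₃) * h3 - hh)

end CharThree

/-! ### Integral models of the Frey curve. -/

/-- The curve `Y² = X (X - A) (X + B)`. -/
def legendreModel {S : Type*} [CommRing S] (A B : S) : WeierstrassCurve S :=
  ⟨0, B - A, 0, -(A * B), 0⟩

theorem legendreModel_map {S T : Type*} [CommRing S] [CommRing T] (f : S →+* T) (A B : S) :
    (legendreModel A B).map f = legendreModel (f A) (f B) := by
  ext <;> simp [legendreModel]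

theorem legendreModel_Δ {S : Type*} [CommRing S] (A B : S) :
    (legendreModel A B).Δ = 16 * A ^ 2 * B ^ 2 * (A + B) ^ 2 := by
  simp only [legendreModel, WeierstrassCurve.Δ, WeierstrassCurve.b₂, WeierstrassCurve.b₄,
    WeierstrassCurve.b₆, WeierstrassCurve.b₈]
  ring

/-- The multiple of 3 is kept apart so that modulo 3 only `16 (B - A)²` survives. -/
theorem legendreModel_c₄ {S : Type*} [CommRing S] (A B : S) :
    (legendreModel A B).c₄ = 16 * (B - A) ^ 2 + 3 * (16 * A * B) := by
  simp only [legendreModel, WeierstrassCurve.c₄, WeierstrassCurve.b₂, WeierstrassCurve.b₄]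
  ring

section Frey

variable {L : Type u} [Field L] [NumberField L] {ζ : L} {r : ℕ}

theorem isIntegral_xi (hr : 0 < r) (hζ : IsPrimitiveRoot ζ r) (n : ℕ) : IsIntegral ℤ (xi ζ n) := by
  refine (isIntegral_algHom_iff ((realField ζ).val.restrictScalars ℤ)
    (realField ζ).val.injective).1 ?_
  change IsIntegral ℤ (ζ ^ n + (ζ ^ n)⁻¹)
  rw [← inv_pow]
  exact ((hζ.isIntegral hr).pow n).add ((hζ.inv.isIntegral hr).pow n)

/-- `ξ_n` as an algebraic integer. -/
noncomputable def xiInt (hr : 0 < r) (hζ : IsPrimitiveRoot ζ r) (n : ℕ) : 𝓞 (realField ζ) :=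
  ⟨xi ζ n, isIntegral_xi hr hζ n⟩

/-- Reduction of `ℤ[ζ]` at a prime above `v`, where `v` lies above `3`. -/
theorem exists_residue_hom (hr : r.Prime) (hr7 : 7 < r) (hζ : IsPrimitiveRoot ζ r)
    (v : HeightOneSpectrum (𝓞 (realField ζ))) (hv : ((3 : ℕ) : 𝓞 (realField ζ)) ∈ v.asIdeal) :
    ∃ (F : Type u) (_ : Field F) (φ : 𝓞 (realField ζ) →+* F) (z : F),
      (∀ x, φ x = 0 ↔ x ∈ v.asIdeal) ∧ z ^ r = 1 ∧ z ≠ 1 ∧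
        ∀ n, φ (xiInt hr.pos hζ n) * z ^ n = z ^ n * z ^ n + 1 := by
  have : v.asIdeal.IsMaximal := v.isMaximal
  obtain ⟨Q, hQ, hQv⟩ :=
    Ideal.exists_maximal_ideal_liesOver_of_isIntegral (S := 𝓞 L) v.asIdeal
  let ζ' : 𝓞 L := ⟨ζ, hζ.isIntegral hr.pos⟩
  have hζ' : IsPrimitiveRoot ζ' r :=
    IsPrimitiveRoot.of_map_of_injective (f := algebraMap (𝓞 L) L) hζ RingOfIntegers.coe_injective
  let _ : Field (𝓞 L ⧸ Q) := Ideal.Quotient.field Q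
  let π : 𝓞 L →+* 𝓞 L ⧸ Q := Ideal.Quotient.mk Q
  have hφ (x : 𝓞 (realField ζ)) :
      (π.comp (algebraMap (𝓞 (realField ζ)) (𝓞 L))) x = 0 ↔ x ∈ v.asIdeal := by
    rw [RingHom.comp_apply, hQv.over, Ideal.mem_comap]
    exact Ideal.Quotient.eq_zero_iff_mem
  refine ⟨𝓞 L ⧸ Q, inferInstance, π.comp (algebraMap _ _), π ζ', hφ, ?_, ?_, fun n => ?_⟩
  · rw [← map_pow, hζ'.pow_eq_one, map_one]
  · intro h
    -- If `z = 1`, the relation `1 + ζ + ⋯ + ζ ^ (r - 1) = 0` reduces to `r = 0`, incompatible with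
    -- `3 = 0` because 3 and `r` are coprime.
    have hgeom := congrArg π (hζ'.geom_sum_eq_zero hr.one_lt)
    simp only [map_sum, map_pow, h, one_pow, Finset.sum_const, Finset.card_range, nsmul_eq_mul,
      mul_one, map_zero] at hgeom
    have h3 := (hφ _).2 hv
    rw [map_natCast] at h3
    have hcop : Nat.Coprime 3 r := (Nat.coprime_primes Nat.prime_three hr).2 (by omega)
    obtain ⟨s, t, hst⟩ := Nat.isCoprime_iff_coprime.2 hcop
    have hst := congrArg (Int.cast : ℤ → 𝓞 L ⧸ Q) hst
    rw [Int.cast_add, Int.cast_mul, Int.cast_mul, Int.cast_natCast, Int.cast_natCast, h3, hgeom,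
      mul_zero, mul_zero, add_zero, Int.cast_one] at hst
    exact zero_ne_one hst
  · rw [RingHom.comp_apply, ← map_pow, ← map_mul, ← map_mul, ← map_one π, ← map_add]
    congr 1
    apply RingOfIntegers.coe_injective
    have h1 : algebraMap (𝓞 L) L (algebraMap (𝓞 (realField ζ)) (𝓞 L) (xiInt hr.pos hζ n))
        = ζ ^ n + (ζ ^ n)⁻¹ := rfl
    have h2 : algebraMap (𝓞 L) L ζ' = ζ := rfl
    have hζ0 : ζ ≠ 0 := hζ.ne_zero hr.ne_zero
    rw [map_mul, map_add, map_mul, map_pow, map_one, h1, h2]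
    field_simp

theorem exists_integral_model (hr : r.Prime) (hr7 : 7 < r) (hζ : IsPrimitiveRoot ζ r)
    {k : ℕ × ℕ × ℕ} (hk : k = (1, 2, 3) ∨ k = (1, 2, 4)) {a b : ℤ} (hab : IsCoprime a b)
    (v : HeightOneSpectrum (𝓞 (realField ζ))) (hv : ((3 : ℕ) : 𝓞 (realField ζ)) ∈ v.asIdeal) :
    ∃ W : WeierstrassCurve (𝓞 (realField ζ)),
      freyCurve ζ k a b = W.map (algebraMap (𝓞 (realField ζ)) (realField ζ)) ∧
        W.Δ ∉ v.asIdeal ∧ W.c₄ ∉ v.asIdeal := by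
  obtain ⟨F, _, φ, z, hφ, hzr, hz1, hx⟩ := exists_residue_hom hr hr7 hζ v hv
  let ξ := xiInt hr.pos hζ
  let A : 𝓞 (realField ζ) :=
    (ξ k.2.2 - ξ k.2.1) * ((a : 𝓞 (realField ζ)) ^ 2 + ξ k.1 * a * b + (b : 𝓞 (realField ζ)) ^ 2)
  let B : 𝓞 (realField ζ) :=
    (ξ k.1 - ξ k.2.2) * ((a : 𝓞 (realField ζ)) ^ 2 + ξ k.2.1 * a * b + (b : 𝓞 (realField ζ)) ^ 2)
  have h3 : (3 : F) = 0 := by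
    have h := (hφ _).2 hv
    rw [map_natCast] at h
    exact_mod_cast h
  have h2 : (2 : F) ≠ 0 := fun h => one_ne_zero (α := F) (by linear_combination h3 - h)
  have hz : z ≠ 0 := by
    rintro rfl
    simp [hr.ne_zero] at hzr
  have h1 (n : ℕ) (h0 : 0 < n) (h7 : n ≤ 7) : z ^ n ≠ 1 := fun h => hz1 <| by
    have hcop : Nat.Coprime n r :=
      ((Nat.Prime.coprime_iff_not_dvd hr).2 fun hd => by
        have := Nat.le_of_dvd h0 hd
        omega).symm
    have := pow_gcd_eq_one.2 ⟨h, hzr⟩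
    rwa [hcop.gcd_eq_one, pow_one] at this
  have hm (m : ℕ) : z ^ m ≠ -1 := fun h => h2 <| by
    have e : (z ^ m) ^ r = 1 := by rw [← pow_mul, mul_comm, pow_mul, hzr, one_pow]
    rw [h, (hr.odd_of_ne_two (by omega)).neg_one_pow] at e
    linear_combination -e
  have hξ (n : ℕ) : φ (ξ n) = z ^ n + (z ^ n)⁻¹ := by
    have := hx n
    have hzn := pow_ne_zero n hz
    field_simp
    linear_combination this
  have hcast (c : ℤ) : (c : F) = 0 ∨ (c : F) = 1 ∨ (c : F) = -1 := by
    obtain ⟨m, hm⟩ : ∃ m, c = 3 * m ∨ c = 3 * m + 1 ∨ c = 3 * m + -1 := ⟨(c + 1) / 3, by omega⟩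
    rcases hm with rfl | rfl | rfl <;> simp [h3]
  have hab0 : (a : F) ≠ 0 ∨ (b : F) ≠ 0 := by
    by_contra! h
    obtain ⟨s, t, hst⟩ := hab
    have hst := congrArg (Int.cast : ℤ → F) hst
    simp [h.1, h.2] at hst
  have hA : φ A = ((z ^ k.2.2 + (z ^ k.2.2)⁻¹) - (z ^ k.2.1 + (z ^ k.2.1)⁻¹)) *
      ((a : F) ^ 2 + (z ^ k.1 + (z ^ k.1)⁻¹) * a * b + (b : F) ^ 2) := by
    simp [A, hξ]
  have hB : φ B = ((z ^ k.1 + (z ^ k.1)⁻¹) - (z ^ k.2.2 + (z ^ k.2.2)⁻¹)) *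
      ((a : F) ^ 2 + (z ^ k.2.1 + (z ^ k.2.1)⁻¹) * a * b + (b : F) ^ 2) := by
    simp [B, hξ]
  -- `A + B` has the same shape as `A` and `B`, with the three indices permuted, so one argument
  -- serves all three factors of `Δ`.
  have hAB : φ A + φ B = -(((z ^ k.2.1 + (z ^ k.2.1)⁻¹) - (z ^ k.1 + (z ^ k.1)⁻¹)) *
      ((a : F) ^ 2 + (z ^ k.2.2 + (z ^ k.2.2)⁻¹) * a * b + (b : F) ^ 2)) := by
    rw [hA, hB]
    ring
  have hk' : 0 < k.1 ∧ k.1 < k.2.1 ∧ k.2.1 < k.2.2 ∧ k.2.2 + k.2.1 ≤ 7 := by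
    rcases hk with rfl | rfl <;> simp
  obtain ⟨hk1, hk2, hk3, hk4⟩ := hk'
  have hquad (n : ℕ) (h0 : 0 < n) (h7 : n ≤ 7) :=
    quadratic_form_ne_zero hz hm h1 h0 h7 (hcast a) (hcast b) hab0
  have hA0 : φ A ≠ 0 := by
    rw [hA]
    exact mul_ne_zero (sub_trace_pow_ne_zero hz h1 hk3 hk4) (hquad _ hk1 (by omega))
  have hB0 : φ B ≠ 0 := by
    rw [hB, ← neg_sub, neg_mul, neg_ne_zero]
    exact mul_ne_zero (sub_trace_pow_ne_zero hz h1 (hk2.trans hk3) (by omega))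
      (hquad _ (by omega) (by omega))
  have hAB0 : φ A + φ B ≠ 0 := by
    rw [hAB, neg_ne_zero]
    exact mul_ne_zero (sub_trace_pow_ne_zero hz h1 hk2 (by omega)) (hquad _ (by omega) (by omega))
  have hH : φ B - φ A ≠ 0 := by
    rw [hA, hB]
    refine hasse_frey_ne_zero h3 _ _ _ ?_ (hcast a) (hcast b) hab0
    rcases hk with rfl | rfl
    · exact hasse_symmetric_ne_zero_one_two_three h3 hz hm h1 fun _ => rfl
    · exact hasse_symmetric_ne_zero_one_two_four h3 hz hm h1 fun _ => rfl
  have h16 : (16 : F) ≠ 0 := by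
    rw [show (16 : F) = 2 ^ 4 by norm_num]
    exact pow_ne_zero 4 h2
  refine ⟨legendreModel A B, ?_, ?_, ?_⟩
  · rw [legendreModel_map]
    have hc (n : ℕ) : algebraMap (𝓞 (realField ζ)) (realField ζ) (ξ n) = xi ζ n := rfl
    have eA : algebraMap (𝓞 (realField ζ)) (realField ζ) A = freyA ζ k a b := by
      simp only [A, freyA, hc, map_mul, map_add, map_sub, map_pow, map_intCast]
    have eB : algebraMap (𝓞 (realField ζ)) (realField ζ) B = freyB ζ k a b := by
      simp only [B, freyB, hc, map_mul, map_add, map_sub, map_pow, map_intCast]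
    rw [eA, eB]
    rfl
  · rw [← hφ, ← WeierstrassCurve.map_Δ, legendreModel_map, legendreModel_Δ]
    exact mul_ne_zero (mul_ne_zero (mul_ne_zero h16 (pow_ne_zero 2 hA0)) (pow_ne_zero 2 hB0))
      (pow_ne_zero 2 hAB0)
  · rw [← hφ, ← WeierstrassCurve.map_c₄, legendreModel_map, legendreModel_c₄, h3, zero_mul,
      add_zero]
    exact mul_ne_zero h16 (pow_ne_zero 2 hH)

/-- `A` and `B` are quadratic forms in `(a, b)`, so a common factor `g` multiplies `a₂` by `g ^ 2`
and `a₄` by `g ^ 4`, which the change of variables with `u = g` undoes. -/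
theorem scale_smul_freyCurve (k : ℕ × ℕ × ℕ) (a b g : ℤ) (hg : (g : realField ζ) ≠ 0) :
    (⟨Units.mk0 (g : realField ζ) hg, 0, 0, 0⟩ : WeierstrassCurve.VariableChange (realField ζ)) •
      freyCurve ζ k (a * g) (b * g) = freyCurve ζ k a b := by
  apply WeierstrassCurve.ext <;>
    simp only [freyCurve, WeierstrassCurve.variableChange_def, freyA, freyB,
      Units.val_inv_eq_inv_val, Units.val_mk0, Int.cast_mul] <;>
    field_simp <;> ring

theorem exists_prime_above_three (K : Type*) [Field K] [NumberField K] :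
    ∃ v : HeightOneSpectrum (𝓞 K), ((3 : ℕ) : 𝓞 K) ∈ v.asIdeal := by
  have : (Ideal.span {(3 : ℤ)}).IsMaximal :=
    PrincipalIdealRing.isMaximal_of_irreducible Int.prime_three.irreducible
  obtain ⟨Q, hQ, hQ3⟩ :=
    Ideal.exists_maximal_ideal_liesOver_of_isIntegral (S := 𝓞 K) (Ideal.span {(3 : ℤ)})
  have hmem : ((3 : ℕ) : 𝓞 K) ∈ Q := by
    have : (3 : ℤ) ∈ Q.comap (algebraMap ℤ (𝓞 K)) := by
      have h := Ideal.mem_span_singleton_self (3 : ℤ)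
      rwa [hQ3.over] at h
    simpa using this
  exact ⟨⟨Q, hQ.isPrime, fun h => by simp [h] at hmem⟩, hmem⟩

end Frey

end FreyOrdinary

theorem theorem3p1 {L : Type*} [Field L] [NumberField L] (r : ℕ) (hr : r.Prime) (hr7 : 7 < r)
    (ζ : L) (hζ : IsPrimitiveRoot ζ r) (k : ℕ × ℕ × ℕ) (hk : k = (1, 2, 3) ∨ k = (1, 2, 4))
    (a b : ℤ) (hab : (a, b) ≠ (0, 0)) :
    (FreyOrdinary.freyCurve ζ k a b).IsElliptic ∧
      FreyOrdinary.IsPOrdinary 3 (FreyOrdinary.freyCurve ζ k a b) := by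
  have hgcd : 0 < Int.gcd a b := by
    rw [Int.gcd_pos_iff]
    by_contra! h
    exact hab (Prod.ext h.1 h.2)
  obtain ⟨a', b', hcop, ha, hb⟩ := Int.exists_gcd_one hgcd
  have hg : ((Int.gcd a b : ℤ) : FreyOrdinary.realField ζ) ≠ 0 := by
    exact_mod_cast hgcd.ne'
  have hscale := FreyOrdinary.scale_smul_freyCurve (ζ := ζ) k a' b' _ hg
  rw [← ha, ← hb] at hscale
  have hmodel := FreyOrdinary.exists_integral_model hr hr7 hζ hk (Int.isCoprime_iff_gcd_eq_one.2 hcop)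
  constructor
  -- The discriminant is nonzero because that of the scaled model is already nonzero modulo a single
  -- prime above 3.
  · obtain ⟨v, hv⟩ := FreyOrdinary.exists_prime_above_three (FreyOrdinary.realField ζ)
    obtain ⟨W, hW, hΔ, -⟩ := hmodel v hv
    rw [WeierstrassCurve.isElliptic_iff, isUnit_iff_ne_zero]
    intro h0
    have h := congrArg WeierstrassCurve.Δ (hscale.trans hW)
    rw [WeierstrassCurve.variableChange_Δ, h0, mul_zero, WeierstrassCurve.map_Δ, eq_comm,
      FaithfulSMul.algebraMap_eq_zero_iff] at h
    exact hΔ (h ▸ zero_mem _)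
  · intro v hv
    obtain ⟨W, hW, hΔ, hc₄⟩ := hmodel v hv
    exact FreyOrdinary.good_ordinary_of_integral_model _ v hv W _ (hscale.trans hW) hΔ hc₄
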